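/- For a polynomial $G$ in $m$ variables with integer coefficients put $V_G^*=\{\mathbf z\in\mathbb A^m_{\mathbb C}:\nabla G(\mathbf z)=\mathbf 0\}$, and for an affine variety $V\subseteq\mathbb A^m_{\mathbb C}$ put $\operatorname{codim}V=m-\dim V$. Let $F\in\mathbb Z[x_1,\dots,x_n]$ be a homogeneous form of degree $d\ge 2$ and let $\mathcal C_0=4(d-1)2^d+1$. For a partition of the variables $\mathbf x=(\mathbf z,\mathbf w)$ write $F_{\mathbf z}(\mathbf z)=F(\mathbf z,\mathbf 0)$. Suppose that for all partitions of variables $\mathbf x=(\mathbf z,\mathbf w)$ and $\mathbf z=(\mathbf s,\mathbf t)$ the form $$\mathfrak G(\mathbf s,\mathbf t)=F_{\mathbf z}(\mathbf s,\mathbf t)-F_{\mathbf z}(\mathbf s,\mathbf 0)-F_{\mathbf z}(\mathbf 0,\mathbf t),$$ a polynomial in the variables $\mathbf z$, satisfies $\operatorname{codim}V_{\mathfrak G}^*\le\mathcal C_0$. Let $\mathbf x=(\mathbf z,\mathbf w)$ be a partition of variables with $\mathbf z=(z_1,\dots,z_h)$, $h\ge 1$, let $\mathfrak F(\mathbf z)=F(\mathbf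 z,\mathbf 0)$, and define, for $\mathbf u=(u_1,\dots,u_h)$ and $\mathbf v=(v_1,\dots,v_h)$, the form $\mathcal G(\mathbf u;\mathbf v)=\mathfrak F(u_1v_1,\dots,u_hv_h)$. Let $$V_{\mathcal G,2}^*=\Big\{(\mathbf u,\mathbf v)\in\mathbb A^{2h}_{\mathbb C}:\ \frac{\partial\mathcal G}{\partial v_i}(\mathbf u;\mathbf v)=0\quad(1\le i\le h)\Big\}.$$ Then $$\operatorname{codim}V_{\mathcal G,2}^*\ \ge\ \operatorname{codim}V_{\mathfrak F}^*-\mathcal C_0 .$$ -/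

import Mathlib

open MvPolynomial

noncomputable section

namespace SemiprimeProp

/-- The dimension of an algebraic set `V ⊆ ℂ^τ`: the Krull dimension of its coordinate ring
`ℂ[τ] / I(V)`. For finite `τ` and nonempty `V` the Krull dimension is a natural number, so that
no default value intervenes (all the loci considered below contain the origin). -/
def affineDim {τ : Type*} (V : Set (τ → ℂ)) : ℕ :=
  ((ringKrullDim (MvPolynomial τ ℂ ⧸ vanishingIdeal ℂ V)).unbotD 0).toNat

/-- The codimension `m - dim V` of an algebraic set `V` in affine `m`-space, `m = #τ`. -/
def affineCodim {τ : Type*} [Fintype τ] (V : Set (τ → ℂ)) : ℤ :=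
  (Fintype.card τ : ℤ) - (affineDim V : ℤ)

/-- The affine variety `V_G^* = {z ∈ ℂ^τ : ∇G(z) = 0}`. -/
def singLocus {τ : Type*} (G : MvPolynomial τ ℤ) : Set (τ → ℂ) :=
  {z | ∀ i, aeval z (pderiv i G) = 0}

/-- The affine variety `V_{G,2}^*` of the points `(u, v)` at which all the partial derivatives of
`G(u; v)` with respect to the second set of variables vanish
(`Sum.inl i` is the variable `u_i`, `Sum.inr i` is the variable `v_i`). -/
def singLocusSnd {τ : Type*} (G : MvPolynomial (τ ⊕ τ) ℤ) : Set (τ ⊕ τ → ℂ) :=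
  {p | ∀ i : τ, aeval p (pderiv (Sum.inr i) G) = 0}

/-- For the partition `x = (z, w)` in which `z` consists of the variables with index in `Z`:
the form `F_z(z) = F(z, 0)`, a polynomial in the variables `z`. -/
def restrictTo {σ : Type*} [DecidableEq σ] (F : MvPolynomial σ ℤ) (Z : Finset σ) :
    MvPolynomial Z ℤ :=
  aeval (fun i : σ => if h : i ∈ Z then (X ⟨i, h⟩ : MvPolynomial Z ℤ) else 0) F

/-- Keep the variables with index in `S` and set the others equal to zero; the result is still
viewed as a polynomial in all the variables. -/
def keepOnly {τ : Type*} [DecidableEq τ] (S : Finset τ) (P : MvPolynomial τ ℤ) :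
    MvPolynomial τ ℤ :=
  aeval (fun i : τ => if i ∈ S then (X i : MvPolynomial τ ℤ) else 0) P

/-- For a partition `z = (s, t)`, where `s` consists of the variables with index in `S` and `t` of
the others: `𝔊(s, t) = P(s, t) - P(s, 0) - P(0, t)`. -/
def mixedPart {τ : Type*} [Fintype τ] [DecidableEq τ] (P : MvPolynomial τ ℤ) (S : Finset τ) :
    MvPolynomial τ ℤ :=
  P - keepOnly S P - keepOnly Sᶜ P

/-- Alternative (II) of the structural dichotomy with respect to `C`: for all partitions
`x = (z, w)` and `z = (s, t)` we have `codim V_𝔊^* ≤ C`, where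
`𝔊(s, t) = F_z(s, t) - F_z(s, 0) - F_z(0, t)`. -/
def SatisfiesII {n : ℕ} (F : MvPolynomial (Fin n) ℤ) (C : ℤ) : Prop :=
  ∀ (Z : Finset (Fin n)) (S : Finset Z),
    affineCodim (singLocus (mixedPart (restrictTo F Z) S)) ≤ C

/-- The form `𝒢(u; v) = P(u_1 v_1, …, u_h v_h)`. -/
def doubled {τ : Type*} (P : MvPolynomial τ ℤ) : MvPolynomial (τ ⊕ τ) ℤ :=
  aeval (fun i : τ => (X (Sum.inl i) * X (Sum.inr i) : MvPolynomial (τ ⊕ τ) ℤ)) P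

/-- The constant `𝒞₀ = 4 (d - 1) 2^d + 1`. -/
def C₀ (d : ℕ) : ℤ := 4 * ((d : ℤ) - 1) * 2 ^ d + 1

end SemiprimeProp

end

/-! Write P for `restrictTo F Z`, in h variables. The chain rule gives ∂𝒢/∂v_i = u_i (∂_i P)(uv),
with uv taken coordinatewise, so (u, v) ↦ uv maps `singLocusSnd (doubled P)` into L = {x_i ∂_i P = 0
for all i}. Imposing the h equations u = v and the pullbacks of dim L linear forms that cut L down
to 0 leaves only the origin, so the locus has dimension at most h + dim L
(`affineDim_singLocusSnd_doubled_le`).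

Sorting the points of L by their support S covers L by the sets `coordSingLocus P S`. Each of these
meets the singular locus of the mixed part for S inside `singLocus P`. That singular locus has
codimension at most `C₀ d`, so the intersection inequality `IsClosedCone.affineDim_add_le_inter`
gives dim L ≤ dim `singLocus P` + `C₀ d`. Subtracting from 2h yields the claim; the value of `C₀ d`
plays no role.

All loci are closed cones, so the dimension theory reduces to one criterion,
`IsClosedCone.isIntegral_of_cut`, together with the existence of linear forms, as many as the
dimension, that cut a cone down to 0. -/

namespace SemiprimeProp

/-! ### Krull dimension: integral maps, unions, hypersurface sections. -/

section KrullDim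

/-- The Krull dimension does not increase along an integral ring homomorphism. -/
theorem ringKrullDim_le_of_isIntegral {A B : Type*} [CommRing A] [CommRing B] (f : A →+* B)
    (hf : f.IsIntegral) : ringKrullDim B ≤ ringKrullDim A := by
  algebraize [f]
  have : Algebra.IsIntegral A B := ⟨hf⟩
  -- Incomparability: contraction keeps strict inclusions of primes strict.
  exact Order.krullDim_le_of_strictMono (PrimeSpectrum.comap (algebraMap A B)) fun p q hpq =>
    Ideal.IsIntegral.comap_lt_comap (R := A) (I := p.asIdeal) (J := q.asIdeal) hpq

/-- Along an injective integral ring homomorphism the Krull dimension does not decrease. -/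
theorem ringKrullDim_le_of_isIntegral_of_injective {A B : Type*} [CommRing A] [CommRing B]
    (f : A →+* B) (hf : f.IsIntegral) (hinj : Function.Injective f) :
    ringKrullDim A ≤ ringKrullDim B := by
  algebraize [f]
  have : Algebra.IsIntegral A B := ⟨hf⟩
  refine iSup_le fun l => ?_
  -- Injectivity provides a prime over the head of the chain; going up lifts the rest.
  obtain ⟨Q, -, hQ, hQl⟩ := Ideal.exists_ideal_over_prime_of_isIntegral (S := B)
    (RelSeries.head l).asIdeal ⊥ (by
      have : RingHom.ker (algebraMap A B) = ⊥ := (RingHom.injective_iff_ker_eq_bot f).1 hinj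
      rw [← RingHom.ker_eq_comap_bot, this]
      exact bot_le)
  have : Q.LiesOver (RelSeries.head l).asIdeal := ⟨hQl.symm⟩
  obtain ⟨L, hL, -⟩ := Ideal.exists_ltSeries_of_hasGoingUp l Q
  rw [← hL]
  exact le_iSup (fun p : LTSeries (PrimeSpectrum B) => (p.length : WithBot ℕ∞)) L

/-- If every prime containing `I` contains one of the ideals `J i`, then `dim A / I` is at most
the maximum of the `dim A / J i`. -/
theorem ringKrullDim_quotient_le_of_forall_prime {A ι : Type*} [CommRing A] (I : Ideal A)
    (J : ι → Ideal A) (n : WithBot ℕ∞) (h : ∀ P : Ideal A, P.IsPrime → I ≤ P → ∃ i, J i ≤ P)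
    (hJ : ∀ i, ringKrullDim (A ⧸ J i) ≤ n) : ringKrullDim (A ⧸ I) ≤ n := by
  rw [ringKrullDim_quotient]
  refine iSup_le fun l => ?_
  obtain ⟨i, hi⟩ := h l.head.1.asIdeal l.head.1.2 l.head.2
  refine le_trans ?_ (hJ i)
  rw [ringKrullDim_quotient]
  let L : LTSeries (PrimeSpectrum.zeroLocus (R := A) (J i)) :=
    { length := l.length
      toFun := fun k => ⟨(l k).1, fun x hx => (l.head_le k : l.head.1.asIdeal ≤ _) (hi hx)⟩
      step := fun k => l.step k }
  exact le_iSup (fun p : LTSeries (PrimeSpectrum.zeroLocus (R := A) (J i)) =>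
    (p.length : WithBot ℕ∞)) L

/-- If `x` avoids the non-maximal minimal primes of `I`, then adding `x` to `I` lowers a positive
dimension. -/
theorem ringKrullDim_quotient_sup_span_singleton_le {A : Type*} [CommRing A] (I : Ideal A) (x : A)
    (r : ℕ) (hI : ringKrullDim (A ⧸ I) ≤ (r + 1 : ℕ))
    (hx : ∀ p ∈ I.minimalPrimes, x ∈ p → p.IsMaximal) :
    ringKrullDim (A ⧸ (I ⊔ Ideal.span {x})) ≤ r := by
  rw [ringKrullDim_quotient]
  refine iSup_le fun l => ?_
  have hl : I ⊔ Ideal.span {x} ≤ l.head.1.asIdeal := l.head.2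
  have := l.head.1.2
  obtain ⟨p, hp, hpl⟩ := Ideal.exists_minimalPrimes_le (le_sup_left.trans hl)
  have hxl : x ∈ l.head.1.asIdeal :=
    hl (Ideal.mem_sup_right (Ideal.mem_span_singleton_self x))
  -- If x lies in p, then p is maximal and the chain is a single point. Otherwise p can be prepended
  -- to the chain inside the zero locus of I.
  by_cases hxp : x ∈ p
  · have hlen : l.length = 0 := by
      by_contra h0
      have hmax := hx p hp hxp
      have h1 : l.head.1.asIdeal < l.last.1.asIdeal :=
        l.strictMono (Fin.lt_def.2 (Nat.pos_of_ne_zero h0))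
      exact l.last.1.2.ne_top (hmax.1.2 _ (hpl.trans_lt h1))
    rw [hlen]
    exact_mod_cast Nat.zero_le r
  · rw [ringKrullDim_quotient] at hI
    let p' : PrimeSpectrum.zeroLocus (R := A) I := ⟨⟨p, hp.1.1⟩, hp.1.2⟩
    let m : LTSeries (PrimeSpectrum.zeroLocus (R := A) I) :=
      l.map (fun q => ⟨q.1, fun y hy => q.2 (Ideal.mem_sup_left hy)⟩) fun _ _ h => h
    have hm : p' < m.head := by
      refine lt_of_le_of_ne hpl fun h => hxp ?_
      have h2 : p = l.head.1.asIdeal := congrArg (fun q => q.1.asIdeal) h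
      rw [h2]
      exact hxl
    have hlen := (le_iSup (fun q : LTSeries (PrimeSpectrum.zeroLocus (R := A) I) =>
      (q.length : WithBot ℕ∞)) (m.cons p' hm)).trans hI
    have h4 : m.length + 1 ≤ r + 1 := by
      rw [RelSeries.cons_length] at hlen
      exact_mod_cast hlen
    exact_mod_cast Nat.le_of_succ_le_succ h4

end KrullDim

/-! ### Affine dimension and closed cones. -/

section Cone

variable {τ : Type*}

/-- The bounds 0 ≤ dim ≤ #τ exclude ⊥ and ⊤, so `unbotD` and `toNat` lose nothing. -/
theorem ringKrullDim_eq_affineDim [Finite τ] {V : Set (τ → ℂ)} (hV : V.Nonempty) :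
    ringKrullDim (MvPolynomial τ ℂ ⧸ vanishingIdeal ℂ V) = affineDim V := by
  have h1 : ringKrullDim (MvPolynomial τ ℂ ⧸ vanishingIdeal ℂ V) ≤ (Nat.card τ : ℕ) := by
    refine (ringKrullDim_quotient_le _).trans ?_
    rw [MvPolynomial.ringKrullDim_of_isNoetherianRing, ringKrullDim_eq_zero_of_field, zero_add]
  have : Nontrivial (MvPolynomial τ ℂ ⧸ vanishingIdeal ℂ V) := by
    rw [Ideal.Quotient.nontrivial_iff, Ideal.ne_top_iff_one]
    obtain ⟨x, hx⟩ := hV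
    exact fun h => one_ne_zero ((map_one (aeval (R := ℂ) x)).symm.trans (h x hx))
  have h0 := ringKrullDim_nonneg_of_nontrivial (R := MvPolynomial τ ℂ ⧸ vanishingIdeal ℂ V)
  unfold affineDim
  generalize ringKrullDim (MvPolynomial τ ℂ ⧸ vanishingIdeal ℂ V) = d at h0 h1
  induction d using WithBot.recBotCoe with
  | bot => simp at h0
  | coe d =>
    induction d using ENat.recTopCoe with
    | top => exact absurd (WithBot.coe_le_coe.1 h1) (by simp)
    | coe d => rfl

theorem affineDim_le_of_subset_iUnion [Finite τ] {ι : Type*} [Finite ι] {U : Set (τ → ℂ)}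
    (hU : U.Nonempty) (V : ι → Set (τ → ℂ)) (hV : ∀ i, (V i).Nonempty) (hUV : U ⊆ ⋃ i, V i)
    (r : ℕ) (h : ∀ i, affineDim (V i) ≤ r) : affineDim U ≤ r := by
  have key : ringKrullDim (MvPolynomial τ ℂ ⧸ vanishingIdeal ℂ U) ≤ r := by
    refine ringKrullDim_quotient_le_of_forall_prime _ (fun i => vanishingIdeal ℂ (V i)) _ ?_ ?_
    · intro P hP hUP
      have := Fintype.ofFinite ι
      have hle : Finset.univ.inf (fun i => vanishingIdeal ℂ (V i)) ≤ P := by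
        refine le_trans (b := vanishingIdeal ℂ U) (fun p hp x hx => ?_) hUP
        obtain ⟨i, hi⟩ := Set.mem_iUnion.1 (hUV hx)
        exact (Finset.inf_le (f := fun i => vanishingIdeal ℂ (V i)) (Finset.mem_univ i) hp) x hi
      obtain ⟨i, -, hi⟩ := (Ideal.IsPrime.inf_le' hP).1 hle
      exact ⟨i, hi⟩
    · intro i
      rw [ringKrullDim_eq_affineDim (hV i)]
      exact_mod_cast h i
  rw [ringKrullDim_eq_affineDim hU] at key
  exact_mod_cast key

theorem affineDim_mono [Finite τ] {U V : Set (τ → ℂ)} (hU : U.Nonempty) (h : U ⊆ V) :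
    affineDim U ≤ affineDim V :=
  affineDim_le_of_subset_iUnion hU (fun _ : Unit => V) (fun _ => hU.mono h)
    (fun _ hx => Set.mem_iUnion.2 ⟨(), h hx⟩) _ fun _ => le_rfl

theorem aeval_smul_of_isHomogeneous {R : Type*} [CommRing R] [Algebra R ℂ] {p : MvPolynomial τ R}
    {n : ℕ} (hp : p.IsHomogeneous n) (c : ℂ) (x : τ → ℂ) :
    aeval (c • x) p = c ^ n * aeval x p := by
  rw [aeval_def, aeval_def, eval₂_eq, eval₂_eq, Finset.mul_sum]
  refine Finset.sum_congr rfl fun s hs => ?_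
  have hn : ∑ i ∈ s.support, s i = n := (hp.degree_eq_sum_deg_support hs).symm
  simp only [Pi.smul_apply, smul_eq_mul, mul_pow, Finset.prod_mul_distrib,
    Finset.prod_pow_eq_pow_sum, hn]
  ring

/-- An algebraic subset of affine space that contains the origin and is stable under scaling. -/
structure IsClosedCone (V : Set (τ → ℂ)) : Prop where
  exists_eq : ∃ S : Set (MvPolynomial τ ℂ), V = {x | ∀ p ∈ S, aeval x p = 0}
  zero_mem : 0 ∈ V
  smul_mem : ∀ (c : ℂ), ∀ x ∈ V, c • x ∈ V

theorem isClosedCone_of_isHomogeneous {ι : Type*} (f : ι → MvPolynomial τ ℤ) (n : ι → ℕ)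
    (hn : ∀ i, n i ≠ 0) (hf : ∀ i, (f i).IsHomogeneous (n i)) :
    IsClosedCone {x : τ → ℂ | ∀ i, aeval x (f i) = 0} where
  exists_eq := by
    refine ⟨Set.range fun i => map (algebraMap ℤ ℂ) (f i), ?_⟩
    ext x
    simp only [Set.mem_ofPred_eq, Set.forall_mem_range, aeval_map_algebraMap]
  zero_mem := fun i => by
    have := aeval_smul_of_isHomogeneous (hf i) 0 (0 : τ → ℂ)
    simpa [zero_pow (hn i)] using this
  smul_mem := fun c x hx i => by rw [aeval_smul_of_isHomogeneous (hf i), hx i, mul_zero]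

theorem IsClosedCone.inter {V W : Set (τ → ℂ)} (hV : IsClosedCone V) (hW : IsClosedCone W) :
    IsClosedCone (V ∩ W) where
  exists_eq := by
    obtain ⟨S, rfl⟩ := hV.exists_eq
    obtain ⟨T, rfl⟩ := hW.exists_eq
    refine ⟨S ∪ T, ?_⟩
    ext x
    simp only [Set.mem_inter_iff, Set.mem_ofPred_eq, Set.mem_union, or_imp, forall_and]
  zero_mem := ⟨hV.zero_mem, hW.zero_mem⟩
  smul_mem := fun c x hx => ⟨hV.smul_mem c x hx.1, hW.smul_mem c x hx.2⟩

theorem IsClosedCone.zeroLocus_vanishingIdeal {V : Set (τ → ℂ)} (hV : IsClosedCone V) :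
    zeroLocus ℂ (vanishingIdeal ℂ V) = V := by
  refine Set.Subset.antisymm (fun x hx => ?_) (zeroLocus_vanishingIdeal_le V)
  obtain ⟨S, rfl⟩ := hV.exists_eq
  exact fun p hp => hx p fun y hy => hy p hp

theorem IsClosedCone.homogeneousComponent_mem {V : Set (τ → ℂ)} (hV : IsClosedCone V)
    {p : MvPolynomial τ ℂ} (hp : p ∈ vanishingIdeal ℂ V) (k : ℕ) :
    homogeneousComponent k p ∈ vanishingIdeal ℂ V := by
  intro x hx
  -- The function c ↦ p(cx), whose coefficients are the values at x of the homogeneous components of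
  -- p. It vanishes for every c because V is stable under scaling.
  let q : Polynomial ℂ := ∑ i ∈ Finset.range (p.totalDegree + 1),
    Polynomial.monomial i (aeval x (homogeneousComponent i p))
  have hq : q = 0 := by
    refine Polynomial.funext fun c => ?_
    have h1 : aeval (c • x) p = 0 := hp _ (hV.smul_mem c x hx)
    rw [← sum_homogeneousComponent p, map_sum] at h1
    simp only [q, Polynomial.eval_finsetSum, Polynomial.eval_monomial, Polynomial.eval_zero]
    rw [← h1]
    refine Finset.sum_congr rfl fun i _ => ?_
    rw [aeval_smul_of_isHomogeneous (homogeneousComponent_isHomogeneous i p), mul_comm]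
  by_cases hk : k ≤ p.totalDegree
  · have h2 := congrArg (fun r => Polynomial.coeff r k) hq
    simpa [q, Polynomial.finsetSum_coeff, Polynomial.coeff_monomial, Nat.lt_succ_iff, hk] using h2
  · rw [homogeneousComponent_eq_zero _ _ (not_le.1 hk), map_zero]

end Cone

/-! ### Cutting cones down to the origin by forms. -/

section Cut

variable {τ : Type*}

theorem homogeneousComponent_mul_of_isHomogeneous {R : Type*} [CommRing R] (q : MvPolynomial τ R)
    {f : MvPolynomial τ R} {n : ℕ} (hf : f.IsHomogeneous n) (k : ℕ) :
    homogeneousComponent k (q * f) =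
      if n ≤ k then homogeneousComponent (k - n) q * f else 0 := by
  let _ : GradedAlgebra (homogeneousSubmodule τ R) := gradedAlgebra
  have h := DirectSum.coe_decompose_mul_of_right_mem (homogeneousSubmodule τ R) (a := q) k
    ((mem_homogeneousSubmodule n f).2 hf)
  have hd : ∀ (i : ℕ) (p : MvPolynomial τ R),
      (DirectSum.decompose (homogeneousSubmodule τ R) p i : MvPolynomial τ R) =
        homogeneousComponent i p := fun i p => decomposition.decompose'_apply p i
  rw [hd, hd] at h
  exact h

/-- If finitely many homogeneous forms of positive degree cut a closed cone down to the origin,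
then its coordinate ring is integral over the algebra they generate. -/
theorem IsClosedCone.isIntegral_of_cut {ι : Type*} [Finite τ] [Finite ι] {V : Set (τ → ℂ)}
    (hV : IsClosedCone V) (f : ι → MvPolynomial τ ℂ) (n : ι → ℕ) (hn : ∀ j, n j ≠ 0)
    (hf : ∀ j, (f j).IsHomogeneous (n j))
    (h : ∀ x ∈ V, (∀ j, aeval x (f j) = 0) → x = 0) :
    ((Ideal.Quotient.mk (vanishingIdeal ℂ V)).comp
      (aeval f : MvPolynomial ι ℂ →ₐ[ℂ] MvPolynomial τ ℂ).toRingHom).IsIntegral := by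
  classical
  have := Fintype.ofFinite ι
  set I := vanishingIdeal ℂ V with hI
  set J := I ⊔ Ideal.span (Set.range f) with hJ
  -- Nullstellensatz: J has no zero other than the origin, so J contains a power of the ideal of the
  -- variables.
  have hrad : idealOfVars τ ℂ ≤ J.radical := by
    rw [← vanishingIdeal_zeroLocus_eq_radical (K := ℂ), idealOfVars, Ideal.span_le]
    rintro _ ⟨i, rfl⟩ x hx
    have hxV : x ∈ V := by
      rw [← hV.zeroLocus_vanishingIdeal]
      exact fun p hp => hx p (Ideal.mem_sup_left hp)
    rw [h x hxV fun j => hx _ (Ideal.mem_sup_right (Ideal.subset_span ⟨j, rfl⟩))]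
    simp
  obtain ⟨N, hN⟩ := Ideal.exists_pow_le_of_le_radical_of_fg hrad (idealOfVars_fg τ ℂ)
  let φ : MvPolynomial ι ℂ →ₐ[ℂ] MvPolynomial τ ℂ := aeval f
  let B : Subalgebra ℂ (MvPolynomial τ ℂ) := φ.range
  let G : Set (MvPolynomial τ ℂ) := (fun s => monomial s 1) '' {s : τ →₀ ℕ | s.degree ≤ N}
  -- Graded Nakayama: induction on the degree shows that L is everything, so the monomials of degree
  -- at most N generate the coordinate ring over B.
  let L : Submodule B (MvPolynomial τ ℂ) := Submodule.span B G ⊔ I.restrictScalars B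
  have hL : ∀ (k : ℕ) (p : MvPolynomial τ ℂ), p.IsHomogeneous k → p ∈ L := by
    intro k
    induction k using Nat.strong_induction_on with
    | _ k ih =>
      intro p hp
      by_cases hk : k ≤ N
      · rw [p.as_sum]
        refine Submodule.sum_mem _ fun s hs => Submodule.mem_sup_left ?_
        have h1 : monomial s (coeff s p) =
            (algebraMap ℂ B (coeff s p)) • (monomial s 1 : MvPolynomial τ ℂ) := by
          rw [algebraMap_smul, smul_monomial, smul_eq_mul, mul_one]
        rw [h1]
        refine Submodule.smul_mem _ _ (Submodule.subset_span ⟨s, ?_, rfl⟩)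
        have : s.degree = k := by
          by_contra hne
          exact (mem_support_iff.1 hs) (hp.coeff_eq_zero hne)
        exact this.trans_le hk
      · have hpJ : p ∈ J := by
          refine hN ((mem_pow_idealOfVars_iff N p).2 fun s hs => ?_)
          have : s.degree = k := by
            by_contra hne
            exact (mem_support_iff.1 hs) (hp.coeff_eq_zero hne)
          omega
        obtain ⟨g, hg, q, hq, hgq⟩ := Submodule.mem_sup.1 hpJ
        obtain ⟨c, rfl⟩ := (Ideal.mem_span_range_iff_exists_fun).1 hq
        -- Taking degree k parts of p = g + ∑ c_j f_j replaces c_j by its component of degree k -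
        -- n_j < k, which the induction hypothesis covers.
        rw [← homogeneousComponent_eq_self hp, ← hgq, map_add, map_sum]
        refine Submodule.add_mem _ (Submodule.mem_sup_right ?_)
          (Submodule.sum_mem _ fun j _ => ?_)
        · exact hV.homogeneousComponent_mem hg k
        · rw [homogeneousComponent_mul_of_isHomogeneous _ (hf j)]
          split_ifs with hjk
          · have h2 : homogeneousComponent (k - n j) (c j) * f j =
                (⟨f j, X j, aeval_X f j⟩ : B) • homogeneousComponent (k - n j) (c j) := by
              rw [Subalgebra.smul_def, smul_eq_mul, mul_comm]
            rw [h2]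
            exact Submodule.smul_mem _ _ (ih _ (by have := hn j; omega) _
              (homogeneousComponent_isHomogeneous _ _))
          · exact Submodule.zero_mem _
  have hfin : Module.Finite B (MvPolynomial τ ℂ ⧸ I) := by
    have hG : G.Finite := (Finsupp.finite_of_degree_le N).image _
    let π : MvPolynomial τ ℂ →ₗ[B] (MvPolynomial τ ℂ ⧸ I) :=
      (IsScalarTower.toAlgHom B (MvPolynomial τ ℂ) (MvPolynomial τ ℂ ⧸ I)).toLinearMap
    refine ⟨?_⟩
    have htop : (⊤ : Submodule B (MvPolynomial τ ℂ ⧸ I)) = (Submodule.span B G).map π := by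
      refine (eq_top_iff.2 fun y _ => ?_).symm
      obtain ⟨p, rfl⟩ := Ideal.Quotient.mk_surjective y
      have hpL : p ∈ L := by
        rw [← sum_homogeneousComponent p]
        exact Submodule.sum_mem _ fun i _ => hL i _ (homogeneousComponent_isHomogeneous i p)
      obtain ⟨a, ha, b, hb, rfl⟩ := Submodule.mem_sup.1 hpL
      refine ⟨a, ha, ?_⟩
      rw [map_add, Ideal.Quotient.eq_zero_iff_mem.2 hb, add_zero]
      rfl
    rw [htop]
    exact (Submodule.fg_span hG).map π
  have hint : (algebraMap B (MvPolynomial τ ℂ ⧸ I)).IsIntegral := fun x =>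
    (Algebra.IsIntegral.of_finite B (MvPolynomial τ ℂ ⧸ I)).isIntegral x
  exact RingHom.IsIntegral.trans φ.rangeRestrict.toRingHom _
    (RingHom.isIntegral_of_surjective _ φ.rangeRestrict_surjective) hint

theorem ringKrullDim_mvPolynomial_complex (ι : Type*) [Finite ι] :
    ringKrullDim (MvPolynomial ι ℂ) = Nat.card ι := by
  rw [MvPolynomial.ringKrullDim_of_isNoetherianRing, ringKrullDim_eq_zero_of_field, zero_add]

theorem IsClosedCone.affineDim_le_of_cut {ι : Type*} [Finite τ] [Finite ι] {V : Set (τ → ℂ)}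
    (hV : IsClosedCone V) (f : ι → MvPolynomial τ ℂ) (n : ι → ℕ) (hn : ∀ j, n j ≠ 0)
    (hf : ∀ j, (f j).IsHomogeneous (n j))
    (h : ∀ x ∈ V, (∀ j, aeval x (f j) = 0) → x = 0) : affineDim V ≤ Nat.card ι := by
  have h1 := ringKrullDim_le_of_isIntegral _ (hV.isIntegral_of_cut f n hn hf h)
  rw [ringKrullDim_eq_affineDim ⟨0, hV.zero_mem⟩, ringKrullDim_mvPolynomial_complex] at h1
  exact_mod_cast h1

/-- Adding suitable linear forms to an ideal whose quotient has dimension at most `r`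
makes the quotient zero-dimensional. -/
theorem exists_linear_forms_ringKrullDim_nonpos [Finite τ] (r : ℕ) :
    ∀ J : Ideal (MvPolynomial τ ℂ), ringKrullDim (MvPolynomial τ ℂ ⧸ J) ≤ r →
      ∃ l : Fin r → MvPolynomial τ ℂ, (∀ j, (l j).IsHomogeneous 1) ∧
        ringKrullDim (MvPolynomial τ ℂ ⧸ (J ⊔ Ideal.span (Set.range l))) ≤ 0 := by
  induction r with
  | zero =>
    intro J hJ
    refine ⟨Fin.elim0, fun j => j.elim0, ?_⟩
    rw [Set.range_eq_empty, Ideal.span_empty, sup_bot_eq]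
    exact_mod_cast hJ
  | succ r ih =>
    intro J hJ
    -- The only prime containing all the variables is the ideal of the origin.
    have hmax : ∀ p : Ideal (MvPolynomial τ ℂ), p.IsPrime → (∀ i, X i ∈ p) → p.IsMaximal := by
      intro p hp hX
      have h0 : vanishingIdeal ℂ {(0 : τ → ℂ)} ≤ p := by
        intro q hq
        have hc : constantCoeff q = 0 := by
          have := (mem_vanishingIdeal_singleton_iff _ _).1 hq
          rwa [aeval_zero] at this
        have hq' : q ∈ Ideal.span (X '' (Set.univ : Set τ)) := by
          rw [mem_ideal_span_X_image]
          intro m hm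
          by_contra! hne
          have : m = 0 := Finsupp.ext fun i => hne i trivial
          exact (mem_support_iff.1 hm) (this ▸ hc)
        refine (Ideal.span_le.2 ?_) hq'
        rintro _ ⟨i, -, rfl⟩
        exact hX i
      have h1 : (vanishingIdeal ℂ {(0 : τ → ℂ)}).IsMaximal := inferInstance
      rwa [← h1.eq_of_le hp.ne_top h0]
    let E := homogeneousSubmodule τ ℂ 1
    let T : Set (Ideal (MvPolynomial τ ℂ)) := {p ∈ J.minimalPrimes | ¬ p.IsMaximal}
    have hT : T.Finite :=
      (Ideal.finite_minimalPrimes_of_isNoetherianRing _ J).subset fun p hp => hp.1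
    have := hT.to_subtype
    -- Prime avoidance for linear forms: a complex vector space is not a finite union of proper
    -- subspaces, and by `hmax` no non-maximal prime contains all linear forms.
    let S : T → Subspace ℂ E := fun p =>
      (Submodule.restrictScalars ℂ p.1).comap E.subtype
    have hS : (⋃ p, (S p : Set E)) ≠ Set.univ := by
      intro hU
      obtain ⟨p, hp⟩ := Subspace.exists_eq_top_of_iUnion_eq_univ hU
      refine p.2.2 (hmax p.1 p.2.1.1.1 fun i => ?_)
      have : (⟨X i, isHomogeneous_X ℂ i⟩ : E) ∈ S p := hp ▸ Submodule.mem_top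
      exact this
    obtain ⟨x, hx⟩ := (Set.ne_univ_iff_exists_notMem _).1 hS
    have hx' : ∀ p ∈ J.minimalPrimes, (x : MvPolynomial τ ℂ) ∈ p → p.IsMaximal := by
      intro p hp hxp
      by_contra hne
      exact hx (Set.mem_iUnion.2 ⟨⟨p, hp, hne⟩, hxp⟩)
    obtain ⟨l, hl, hd⟩ := ih _ (ringKrullDim_quotient_sup_span_singleton_le J x r hJ hx')
    refine ⟨Fin.cons (x : MvPolynomial τ ℂ) l, Fin.cases x.2 hl, ?_⟩
    rwa [Fin.range_cons, Set.insert_eq, Ideal.span_union, ← sup_assoc]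

/-- A closed cone of dimension `r` is cut down to the origin by `r` linear forms. -/
theorem IsClosedCone.exists_linear_cut [Finite τ] {V : Set (τ → ℂ)} (hV : IsClosedCone V) :
    ∃ l : Fin (affineDim V) → MvPolynomial τ ℂ, (∀ j, (l j).IsHomogeneous 1) ∧
      ∀ x ∈ V, (∀ j, aeval x (l j) = 0) → x = 0 := by
  obtain ⟨l, hl, hd⟩ := exists_linear_forms_ringKrullDim_nonpos (affineDim V)
    (vanishingIdeal ℂ V) (ringKrullDim_eq_affineDim ⟨0, hV.zero_mem⟩).le
  refine ⟨l, hl, fun x hx hlx => ?_⟩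
  by_contra hx0
  obtain ⟨i, hi⟩ := Function.ne_iff.1 hx0
  set K := vanishingIdeal ℂ V ⊔ Ideal.span (Set.range l) with hK
  -- Restriction to the line ℂx. A nonzero x would make its kernel a prime over K strictly below the
  -- ideal of the origin, contradicting dimension zero.
  let ψ : MvPolynomial τ ℂ →ₐ[ℂ] Polynomial ℂ := aeval fun j => Polynomial.C (x j) * Polynomial.X
  have hψ : ∀ (c : ℂ) (p : MvPolynomial τ ℂ), (ψ p).eval c = aeval (c • x) p := by
    intro c p
    have : (Polynomial.aeval c).comp ψ = aeval (c • x) := by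
      ext j
      rw [AlgHom.comp_apply, aeval_X, aeval_X, map_mul, Polynomial.aeval_C, Polynomial.aeval_X,
        Pi.smul_apply, smul_eq_mul, mul_comm]
      rfl
    rw [← this]
    rfl
  have hKP : K ≤ RingHom.ker ψ.toRingHom := by
    refine sup_le (fun p hp => Polynomial.funext fun c => ?_) (Ideal.span_le.2 ?_)
    · exact (hψ c p).trans ((hp _ (hV.smul_mem c x hx)).trans Polynomial.eval_zero.symm)
    · rintro _ ⟨j, rfl⟩
      refine Polynomial.funext fun c => (hψ c _).trans ?_
      rw [aeval_smul_of_isHomogeneous (hl j), hlx j, mul_zero, Polynomial.eval_zero]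
  have hPM : RingHom.ker ψ.toRingHom ≤ vanishingIdeal ℂ {(0 : τ → ℂ)} := by
    intro p hp
    have h1 : ψ p = 0 := hp
    rw [mem_vanishingIdeal_singleton_iff, ← zero_smul ℂ x, ← hψ, h1, Polynomial.eval_zero]
  rw [ringKrullDim_quotient, Order.krullDim_nonpos_iff_forall_isMax] at hd
  let P : PrimeSpectrum.zeroLocus (R := MvPolynomial τ ℂ) K :=
    ⟨⟨RingHom.ker ψ.toRingHom, RingHom.ker_isPrime _⟩, hKP⟩
  let M : PrimeSpectrum.zeroLocus (R := MvPolynomial τ ℂ) K :=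
    ⟨⟨vanishingIdeal ℂ {(0 : τ → ℂ)}, inferInstance⟩, hKP.trans hPM⟩
  have hMP : vanishingIdeal ℂ {(0 : τ → ℂ)} ≤ RingHom.ker ψ.toRingHom :=
    hd P (show P ≤ M from hPM)
  have hXi : ψ (X i) = 0 := hMP ((mem_vanishingIdeal_singleton_iff _ _).2 (by simp))
  have h2 := hψ 1 (X i)
  rw [hXi] at h2
  simp at h2
  exact hi h2.symm

/-- Linear forms, as many as the dimension, that cut a closed cone down to the origin are
algebraically independent on the cone. -/
theorem IsClosedCone.eq_zero_of_aeval_cut [Finite τ] {V : Set (τ → ℂ)} (hV : IsClosedCone V)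
    (l : Fin (affineDim V) → MvPolynomial τ ℂ) (hl : ∀ j, (l j).IsHomogeneous 1)
    (hcut : ∀ x ∈ V, (∀ j, aeval x (l j) = 0) → x = 0)
    (g : MvPolynomial (Fin (affineDim V)) ℂ)
    (hg : ∀ x ∈ V, aeval (fun j => aeval x (l j)) g = 0) : g = 0 := by
  by_contra hg0
  have hint := hV.isIntegral_of_cut l (fun _ => 1) (fun _ => one_ne_zero) hl hcut
  set φ := (Ideal.Quotient.mk (vanishingIdeal ℂ V)).comp
      (aeval l : MvPolynomial (Fin (affineDim V)) ℂ →ₐ[ℂ] MvPolynomial τ ℂ).toRingHom with hφ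
  have hφg : φ g = 0 := by
    refine Ideal.Quotient.eq_zero_iff_mem.2 fun x hx => ?_
    rw [← hg x hx]
    have : (aeval x).comp (aeval l) =
        (aeval fun j => aeval x (l j) : MvPolynomial (Fin (affineDim V)) ℂ →ₐ[ℂ] ℂ) := by
      ext j
      simp
    rw [← this]
    rfl
  -- A nonzero relation g drops the dimension of the image below `affineDim V`, although the
  -- coordinate ring of V is integral over that image.
  have h1 : ringKrullDim φ.range + 1 ≤ ringKrullDim (MvPolynomial (Fin (affineDim V)) ℂ) :=
    ringKrullDim_succ_le_of_surjective φ.rangeRestrict φ.rangeRestrict_surjective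
      (mem_nonZeroDivisors_of_ne_zero hg0) (Subtype.ext hφg)
  have h2 : ringKrullDim (MvPolynomial τ ℂ ⧸ vanishingIdeal ℂ V) ≤ ringKrullDim φ.range := by
    refine ringKrullDim_le_of_isIntegral φ.range.subtype ?_
    exact RingHom.IsIntegral.tower_top φ.rangeRestrict _ hint
  rw [ringKrullDim_eq_affineDim ⟨0, hV.zero_mem⟩] at h2
  rw [ringKrullDim_mvPolynomial_complex, Nat.card_fin] at h1
  have h3 : ((affineDim V + 1 : ℕ) : WithBot ℕ∞) ≤ affineDim V := by
    push_cast
    exact (add_le_add_left h2 1).trans h1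
  have h4 : affineDim V + 1 ≤ affineDim V := by exact_mod_cast h3
  omega

end Cut

/-! ### Products and intersections of cones. -/

section Intersection

variable {τ σ : Type*}

/-- The product of two subsets of affine spaces. -/
def prodSet (V : Set (τ → ℂ)) (W : Set (σ → ℂ)) : Set (τ ⊕ σ → ℂ) :=
  {p | p ∘ Sum.inl ∈ V ∧ p ∘ Sum.inr ∈ W}

theorem IsClosedCone.prodSet {V : Set (τ → ℂ)} {W : Set (σ → ℂ)} (hV : IsClosedCone V)
    (hW : IsClosedCone W) : IsClosedCone (prodSet V W) where
  exists_eq := by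
    obtain ⟨S, rfl⟩ := hV.exists_eq
    obtain ⟨T, rfl⟩ := hW.exists_eq
    refine ⟨rename Sum.inl '' S ∪ rename Sum.inr '' T, ?_⟩
    ext x
    simp only [SemiprimeProp.prodSet, Set.mem_ofPred_eq, Set.mem_union, or_imp, forall_and,
      Set.forall_mem_image, aeval_rename]
  zero_mem := ⟨hV.zero_mem, hW.zero_mem⟩
  smul_mem := fun c x hx => ⟨hV.smul_mem c _ hx.1, hW.smul_mem c _ hx.2⟩

/-- A polynomial in two sets of variables vanishes if it vanishes on a product of two sets each
of which annihilates no nonzero polynomial. -/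
theorem eq_zero_of_aeval_sumElim {α β : Type*} (A : Set (α → ℂ)) (B : Set (β → ℂ))
    (hA : ∀ g : MvPolynomial α ℂ, (∀ a ∈ A, aeval a g = 0) → g = 0)
    (hB : ∀ g : MvPolynomial β ℂ, (∀ b ∈ B, aeval b g = 0) → g = 0)
    (g : MvPolynomial (α ⊕ β) ℂ) (hg : ∀ a ∈ A, ∀ b ∈ B, aeval (Sum.elim a b) g = 0) : g = 0 := by
  have hl : ∀ (a : α → ℂ) (b : β → ℂ),
      aeval a (aeval (Sum.elim X fun j => C (b j)) g : MvPolynomial α ℂ) =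
        aeval (Sum.elim a b) g := by
    intro a b
    have : (aeval a).comp (aeval (Sum.elim X fun j => C (b j)) :
        MvPolynomial (α ⊕ β) ℂ →ₐ[ℂ] MvPolynomial α ℂ) = aeval (Sum.elim a b) := by
      ext (j | j) <;> simp
    rw [← this]
    rfl
  have hr : ∀ (a : α → ℂ) (b : β → ℂ),
      aeval b (aeval (Sum.elim (fun j => C (a j)) X) g : MvPolynomial β ℂ) =
        aeval (Sum.elim a b) g := by
    intro a b
    have : (aeval b).comp (aeval (Sum.elim (fun j => C (a j)) X) :
        MvPolynomial (α ⊕ β) ℂ →ₐ[ℂ] MvPolynomial β ℂ) = aeval (Sum.elim a b) := by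
      ext (j | j) <;> simp
    rw [← this]
    rfl
  -- One set of variables is freed at a time.
  have h1 : ∀ (a : α → ℂ), ∀ b ∈ B, aeval (Sum.elim a b) g = 0 := by
    intro a b hb
    rw [← hl, hA _ fun a' ha' => (hl a' b).trans (hg a' ha' b hb), map_zero]
  have h2 : ∀ (a : α → ℂ) (b : β → ℂ), aeval (Sum.elim a b) g = 0 := by
    intro a b
    rw [← hr, hB _ fun b' hb' => (hr a b').trans (h1 a b' hb'), map_zero]
  refine MvPolynomial.funext fun p => ?_
  rw [map_zero, ← Sum.elim_comp_inl_inr p]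
  exact h2 _ _

/-- The linear cuts of V and of W together cut the product down to 0 and stay algebraically
independent on it, so the coordinate ring of the product is integral over a polynomial ring in dim V
+ dim W variables. -/
theorem IsClosedCone.add_le_affineDim_prodSet [Finite τ] [Finite σ] {V : Set (τ → ℂ)}
    {W : Set (σ → ℂ)} (hV : IsClosedCone V) (hW : IsClosedCone W) :
    affineDim V + affineDim W ≤ affineDim (SemiprimeProp.prodSet V W) := by
  obtain ⟨l, hl, hlV⟩ := hV.exists_linear_cut
  obtain ⟨m, hm, hmW⟩ := hW.exists_linear_cut
  have hP := hV.prodSet hW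
  let f : Fin (affineDim V) ⊕ Fin (affineDim W) → MvPolynomial (τ ⊕ σ) ℂ :=
    Sum.elim (fun j => rename Sum.inl (l j)) (fun j => rename Sum.inr (m j))
  have hf : ∀ j, (f j).IsHomogeneous 1 := by
    rintro (j | j)
    · exact (hl j).rename_isHomogeneous
    · exact (hm j).rename_isHomogeneous
  have hfl : ∀ (x : τ ⊕ σ → ℂ) j, aeval x (f (Sum.inl j)) = aeval (x ∘ Sum.inl) (l j) :=
    fun x j => aeval_rename _ _ _
  have hfr : ∀ (x : τ ⊕ σ → ℂ) j, aeval x (f (Sum.inr j)) = aeval (x ∘ Sum.inr) (m j) :=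
    fun x j => aeval_rename _ _ _
  have hint := hP.isIntegral_of_cut f (fun _ => 1) (fun _ => one_ne_zero) hf (by
    intro x hx h0
    have h1 : x ∘ Sum.inl = 0 := hlV _ hx.1 fun j => (hfl x j).symm.trans (h0 _)
    have h2 : x ∘ Sum.inr = 0 := hmW _ hx.2 fun j => (hfr x j).symm.trans (h0 _)
    rw [← Sum.elim_comp_inl_inr x, h1, h2]
    exact Sum.elim_zero_zero)
  have hdim := ringKrullDim_le_of_isIntegral_of_injective _ hint (by
    rw [injective_iff_map_eq_zero]
    intro g hg
    have hg' : ∀ x ∈ SemiprimeProp.prodSet V W, aeval x (aeval f g) = 0 :=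
      Ideal.Quotient.eq_zero_iff_mem.1 hg
    refine eq_zero_of_aeval_sumElim ((fun x j => aeval x (l j)) '' V)
      ((fun y j => aeval y (m j)) '' W) ?_ ?_ g ?_
    · exact fun q hq => hV.eq_zero_of_aeval_cut l hl hlV q fun x hx => hq _ ⟨x, hx, rfl⟩
    · exact fun q hq => hW.eq_zero_of_aeval_cut m hm hmW q fun x hx => hq _ ⟨x, hx, rfl⟩
    · rintro _ ⟨x, hx, rfl⟩ _ ⟨y, hy, rfl⟩
      rw [← hg' (Sum.elim x y) ⟨hx, hy⟩]
      have : (aeval (Sum.elim x y)).comp (aeval f) =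
          (aeval (Sum.elim (fun j => aeval x (l j)) fun j => aeval y (m j)) :
            MvPolynomial (Fin (affineDim V) ⊕ Fin (affineDim W)) ℂ →ₐ[ℂ] ℂ) := by
        ext (j | j)
        · rw [AlgHom.comp_apply, aeval_X, aeval_X, hfl]
          rfl
        · rw [AlgHom.comp_apply, aeval_X, aeval_X, hfr]
          rfl
      rw [← this]
      rfl)
  rw [ringKrullDim_eq_affineDim ⟨0, hP.zero_mem⟩, ringKrullDim_mvPolynomial_complex, Nat.card_sum,
    Nat.card_fin, Nat.card_fin] at hdim
  exact_mod_cast hdim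

/-- The dimension of the intersection of two closed cones. -/
theorem IsClosedCone.affineDim_add_le_inter [Finite τ] {V W : Set (τ → ℂ)} (hV : IsClosedCone V)
    (hW : IsClosedCone W) : affineDim V + affineDim W ≤ affineDim (V ∩ W) + Nat.card τ := by
  obtain ⟨l, hl, hcut⟩ := (hV.inter hW).exists_linear_cut
  -- Reduction to the diagonal: the #τ equations of the diagonal turn V × W into V ∩ W, which the
  -- forms `l` cut down to 0.
  let f : τ ⊕ Fin (affineDim (V ∩ W)) → MvPolynomial (τ ⊕ τ) ℂ :=
    Sum.elim (fun i => X (Sum.inl i) - X (Sum.inr i)) (fun j => rename Sum.inl (l j))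
  refine (hV.add_le_affineDim_prodSet hW).trans
    (((hV.prodSet hW).affineDim_le_of_cut f (fun _ => 1) (fun _ => one_ne_zero) ?_ ?_).trans ?_)
  · rintro (j | j)
    · exact (isHomogeneous_X _ _).sub (isHomogeneous_X _ _)
    · exact (hl j).rename_isHomogeneous
  · intro x hx h0
    have h1 : x ∘ Sum.inl = x ∘ Sum.inr := by
      ext i
      have := h0 (Sum.inl i)
      simpa [f, sub_eq_zero] using this
    have h2 : x ∘ Sum.inl = 0 := hcut _ ⟨hx.1, h1 ▸ hx.2⟩ fun j => by
      have := h0 (Sum.inr j)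
      rwa [← aeval_rename]
    rw [← Sum.elim_comp_inl_inr x, ← h1, h2]
    exact Sum.elim_zero_zero
  · rw [Nat.card_sum, Nat.card_fin, add_comm]

end Intersection

/-! ### The loci attached to P and their dimensions. -/

section Loci

variable {τ : Type*}

theorem isHomogeneous_restrictTo {σ : Type*} [DecidableEq σ] {F : MvPolynomial σ ℤ} {d : ℕ}
    (hF : F.IsHomogeneous d) (Z : Finset σ) : (restrictTo F Z).IsHomogeneous d := by
  rw [← one_mul d]
  refine hF.aeval _ fun i => ?_
  split_ifs
  · exact isHomogeneous_X _ _
  · exact isHomogeneous_zero _ _ _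

theorem isHomogeneous_keepOnly [DecidableEq τ] {P : MvPolynomial τ ℤ} {d : ℕ}
    (hP : P.IsHomogeneous d) (S : Finset τ) : (keepOnly S P).IsHomogeneous d := by
  rw [← one_mul d]
  refine hP.aeval _ fun i => ?_
  split_ifs
  · exact isHomogeneous_X _ _
  · exact isHomogeneous_zero _ _ _

theorem isHomogeneous_doubled {P : MvPolynomial τ ℤ} {d : ℕ} (hP : P.IsHomogeneous d) :
    (doubled P).IsHomogeneous (2 * d) :=
  hP.aeval _ fun _ => (isHomogeneous_X _ _).mul (isHomogeneous_X _ _)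

theorem isClosedCone_singLocus {P : MvPolynomial τ ℤ} {d : ℕ} (hd : 2 ≤ d)
    (hP : P.IsHomogeneous d) : IsClosedCone (singLocus P) :=
  isClosedCone_of_isHomogeneous (fun i => pderiv i P) (fun _ => d - 1) (fun _ => by omega)
    fun _ => hP.pderiv

theorem isClosedCone_singLocusSnd {P : MvPolynomial (τ ⊕ τ) ℤ} {d : ℕ} (hd : 2 ≤ d)
    (hP : P.IsHomogeneous d) : IsClosedCone (singLocusSnd P) :=
  isClosedCone_of_isHomogeneous (fun i => pderiv (Sum.inr i) P) (fun _ => d - 1)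
    (fun _ => by omega) fun _ => hP.pderiv

/-- The partial derivatives of a polynomial after setting the variables outside `S` to zero. -/
theorem pderiv_keepOnly [DecidableEq τ] (S : Finset τ) (P : MvPolynomial τ ℤ) (i : τ) :
    pderiv i (keepOnly S P) = if i ∈ S then keepOnly S (pderiv i P) else 0 := by
  unfold keepOnly
  induction P using MvPolynomial.induction_on with
  | C a => simp
  | add p q hp hq => simp only [map_add, hp, hq]; split_ifs <;> simp
  | mul_X p j hp =>
    simp only [map_mul, aeval_X, Derivation.leibniz, smul_eq_mul, map_add, hp]
    by_cases hij : j = i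
    · subst hij
      by_cases hj : j ∈ S <;> simp [hj]
    · by_cases hi : i ∈ S <;> by_cases hj : j ∈ S <;>
        simp [hi, hj, pderiv_X_of_ne hij]

theorem pderiv_inr_doubled (P : MvPolynomial τ ℤ) (i : τ) :
    pderiv (Sum.inr i) (doubled P) = X (Sum.inl i) * doubled (pderiv i P) := by
  classical
  unfold doubled
  induction P using MvPolynomial.induction_on with
  | C a => simp
  | add p q hp hq => simp only [map_add, hp, hq]; ring
  | mul_X p j hp =>
    simp only [map_mul, aeval_X, Derivation.leibniz, smul_eq_mul, map_add, hp]
    by_cases hij : j = i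
    · subst hij
      simp
      ring
    · have h1 : (Sum.inr j : τ ⊕ τ) ≠ Sum.inr i := fun h => hij (Sum.inr_injective h)
      simp [hij, h1]
      ring

theorem aeval_doubled (P : MvPolynomial τ ℤ) (p : τ ⊕ τ → ℂ) :
    aeval p (doubled P) = aeval (fun i => p (Sum.inl i) * p (Sum.inr i)) P := by
  have : (aeval p).comp (aeval fun i : τ => (X (Sum.inl i) * X (Sum.inr i) :
      MvPolynomial (τ ⊕ τ) ℤ)) =
        (aeval fun i => p (Sum.inl i) * p (Sum.inr i) : MvPolynomial τ ℤ →ₐ[ℤ] ℂ) := by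
    ext j
    simp
  rw [← this]
  rfl

theorem aeval_keepOnly [DecidableEq τ] (S : Finset τ) (P : MvPolynomial τ ℤ) (x : τ → ℂ) :
    aeval x (keepOnly S P) = aeval (fun i => if i ∈ S then x i else 0) P := by
  have : (aeval x).comp (aeval fun i : τ => if i ∈ S then (X i : MvPolynomial τ ℤ) else 0) =
        (aeval fun i => if i ∈ S then x i else 0 : MvPolynomial τ ℤ →ₐ[ℤ] ℂ) := by
    ext j
    by_cases hj : j ∈ S <;> simp [hj]
  rw [← this]
  rfl

/-- The singular locus of the restriction of `P` to the coordinate subspace spanned by `S`, as a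
subset of the ambient space. -/
def coordSingLocus [DecidableEq τ] (P : MvPolynomial τ ℤ) (S : Finset τ) : Set (τ → ℂ) :=
  {x | ∀ i, aeval x (if i ∈ S then pderiv i P else X i) = 0}

theorem isClosedCone_coordSingLocus [DecidableEq τ] {P : MvPolynomial τ ℤ} {d : ℕ} (hd : 2 ≤ d)
    (hP : P.IsHomogeneous d) (S : Finset τ) : IsClosedCone (coordSingLocus P S) := by
  refine isClosedCone_of_isHomogeneous _ (fun i => if i ∈ S then d - 1 else 1) (fun i => ?_)
    fun i => ?_
  · split_ifs <;> omega
  · split_ifs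
    · exact hP.pderiv
    · exact isHomogeneous_X _ _

/-- The points `x` with `x_i ∂_i P(x) = 0` for all `i`. -/
def logSingLocus (P : MvPolynomial τ ℤ) : Set (τ → ℂ) :=
  {x | ∀ i, aeval x (X i * pderiv i P) = 0}

theorem isClosedCone_logSingLocus {P : MvPolynomial τ ℤ} {d : ℕ} (hP : P.IsHomogeneous d) :
    IsClosedCone (logSingLocus P) :=
  isClosedCone_of_isHomogeneous _ (fun _ => 1 + (d - 1)) (fun _ => by omega)
    fun _ => (isHomogeneous_X _ _).mul hP.pderiv

theorem logSingLocus_subset [Fintype τ] [DecidableEq τ] (P : MvPolynomial τ ℤ) :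
    logSingLocus P ⊆ ⋃ S, coordSingLocus P S := by
  classical
  intro x hx
  -- S is the support of x: on it x_i can be cancelled from x_i ∂_i P(x) = 0.
  refine Set.mem_iUnion.2 ⟨Finset.univ.filter fun i => x i ≠ 0, fun i => ?_⟩
  by_cases hi : x i = 0
  · simp [hi]
  · have := hx i
    simpa [hi] using this

/-- For i in S, ∂_i P vanishes by definition of `coordSingLocus`. For i outside S, the mixed part
has i-th derivative ∂_i P - (∂_i P)(0, t), and t = 0 on the coordinate subspace; the correction is
then ∂_i P(0), which is 0 since d ≥ 2. -/
theorem coordSingLocus_inter_singLocus_mixedPart_subset [Fintype τ] [DecidableEq τ]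
    {P : MvPolynomial τ ℤ} {d : ℕ} (hd : 2 ≤ d) (hP : P.IsHomogeneous d) (S : Finset τ) :
    coordSingLocus P S ∩ singLocus (mixedPart P S) ⊆ singLocus P := by
  rintro x ⟨hx, hxG⟩ i
  by_cases hi : i ∈ S
  · have := hx i
    rwa [if_pos hi] at this
  · have hG := hxG i
    have h0 : (fun j => if j ∈ Sᶜ then x j else 0) = 0 := by
      ext j
      by_cases hj : j ∈ S
      · simp [hj]
      · have := hx j
        simpa [hj] using this
    rw [mixedPart, Derivation.map_sub, Derivation.map_sub, pderiv_keepOnly, pderiv_keepOnly,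
      if_neg hi, if_pos (Finset.mem_compl.2 hi), sub_zero, map_sub, aeval_keepOnly, h0,
      (isClosedCone_singLocus hd hP).zero_mem i, sub_zero] at hG
    exact hG

theorem affineDim_singLocusSnd_doubled_le [Fintype τ] {P : MvPolynomial τ ℤ} {d : ℕ} (hd : 2 ≤ d)
    (hP : P.IsHomogeneous d) :
    affineDim (singLocusSnd (doubled P)) ≤ Fintype.card τ + affineDim (logSingLocus P) := by
  obtain ⟨l, hl, hcut⟩ := (isClosedCone_logSingLocus hP).exists_linear_cut
  let f : τ ⊕ Fin (affineDim (logSingLocus P)) → MvPolynomial (τ ⊕ τ) ℂ :=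
    Sum.elim (fun i => X (Sum.inl i) - X (Sum.inr i))
      (fun j => aeval (fun i => X (Sum.inl i) * X (Sum.inr i)) (l j))
  refine ((isClosedCone_singLocusSnd (by omega) (isHomogeneous_doubled hP)).affineDim_le_of_cut f
    (Sum.elim (fun _ => 1) fun _ => 2) ?_ ?_ ?_).trans ?_
  · rintro (j | j) <;> simp
  · rintro (j | j)
    · exact (isHomogeneous_X _ _).sub (isHomogeneous_X _ _)
    · exact (hl j).aeval _ fun i => (isHomogeneous_X _ _).mul (isHomogeneous_X _ _)
  · intro p hp h0
    have h1 : ∀ i, p (Sum.inl i) = p (Sum.inr i) := fun i => by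
      have := h0 (Sum.inl i)
      simpa [f, sub_eq_zero] using this
    have h2 : (fun i => p (Sum.inl i) * p (Sum.inr i)) = 0 := by
      refine hcut _ (fun i => ?_) fun j => ?_
      · have h3 := hp i
        rw [pderiv_inr_doubled, map_mul, aeval_X, aeval_doubled] at h3
        -- Multiplying u_i (∂_i P)(uv) = 0 by v_i puts uv in `logSingLocus P`.
        rw [map_mul, aeval_X, mul_right_comm, h3, zero_mul]
      · have h3 := h0 (Sum.inr j)
        have h4 : (aeval p).comp (aeval fun i : τ => (X (Sum.inl i) * X (Sum.inr i) :
            MvPolynomial (τ ⊕ τ) ℂ)) =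
              (aeval fun i => p (Sum.inl i) * p (Sum.inr i) : MvPolynomial τ ℂ →ₐ[ℂ] ℂ) := by
          ext j
          simp
        rw [← h4]
        exact h3
    -- With u = v, the equation uv = 0 says that each v_i² is 0.
    have h5 : ∀ i, p (Sum.inr i) = 0 := fun i => by
      have := congrFun h2 i
      simpa [h1 i] using this
    ext (i | i)
    · rw [h1 i, h5 i, Pi.zero_apply]
    · rw [h5 i, Pi.zero_apply]
  · rw [Nat.card_sum, Nat.card_fin, Nat.card_eq_fintype_card]

end Loci

end SemiprimeProp

theorem mainTheorem4 (n d : ℕ) (hd : 2 ≤ d) (F : MvPolynomial (Fin n) ℤ)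
    (hF : F.IsHomogeneous d) (hII : SemiprimeProp.SatisfiesII F (SemiprimeProp.C₀ d))
    (Z : Finset (Fin n)) (hZ : 1 ≤ Z.card) :
    SemiprimeProp.affineCodim (SemiprimeProp.singLocus (SemiprimeProp.restrictTo F Z))
        - SemiprimeProp.C₀ d ≤
      SemiprimeProp.affineCodim
        (SemiprimeProp.singLocusSnd (SemiprimeProp.doubled (SemiprimeProp.restrictTo F Z))) := by
  open SemiprimeProp in
  have hP := isHomogeneous_restrictTo hF Z
  set P := restrictTo F Z
  have hbound : ∀ S : Finset Z,
      (affineDim (coordSingLocus P S) : ℤ) ≤ affineDim (singLocus P) + C₀ d := by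
    intro S
    have hX := isClosedCone_coordSingLocus hd hP S
    have hY : IsClosedCone (singLocus (mixedPart P S)) :=
      isClosedCone_singLocus hd
        ((hP.sub (isHomogeneous_keepOnly hP S)).sub (isHomogeneous_keepOnly hP Sᶜ))
    have h1 := hX.affineDim_add_le_inter hY
    have h2 := affineDim_mono ⟨0, (hX.inter hY).zero_mem⟩
      (coordSingLocus_inter_singLocus_mixedPart_subset hd hP S)
    have h3 : affineCodim (singLocus (mixedPart P S)) ≤ C₀ d := hII Z S
    unfold affineCodim at h3
    rw [Nat.card_eq_fintype_card] at h1
    omega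
  -- Nonnegativity makes the `toNat` in the next bound lossless.
  have hC : 0 ≤ (affineDim (singLocus P) : ℤ) + C₀ d := (Int.natCast_nonneg _).trans (hbound ∅)
  have hU : affineDim (logSingLocus P) ≤ ((affineDim (singLocus P) : ℤ) + C₀ d).toNat :=
    affineDim_le_of_subset_iUnion ⟨0, (isClosedCone_logSingLocus hP).zero_mem⟩ _
      (fun S => ⟨0, (isClosedCone_coordSingLocus hd hP S).zero_mem⟩) (logSingLocus_subset P) _
      fun S => by have := hbound S; omega
  have hG := affineDim_singLocusSnd_doubled_le hd hP
  unfold affineCodim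
  rw [Fintype.card_sum]
  push_cast
  omega
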